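/- All graphs are finite, simple and nonempty. The clique-width of a graph $G$ is the minimum number of labels needed to construct $G$ using the following four operations: creating a new graph consisting of a single vertex with label $i$; taking the disjoint union of two labelled graphs; joining each vertex with label $i$ to each vertex with label $j$, where $i \neq j$; and renaming label $i$ to $j$. A graph is a split graph if its vertex set can be partitioned into a (possibly empty) clique and a (possibly empty) independent set. Let $F_3$ be the graph with vertices $a,b,c,d,y,z$ and edges $ab, ac, ad, bc, bd, cd, za, zb, yb$. A graph is $F_3$-free if no induced subgraph of it is isomorphic to $F_3$. Theorem. The class of $F_3$-free split graphs has bounded clique-width; that is, there is a constant $c$ such that every $F_3$-free split graph has clique-width at most $c$. -/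

import Mathlib

open scoped SimpleGraph

universe u

/-- `G` is a split graph: its vertex set can be partitioned into a (possibly empty) clique `K`
and a (possibly empty) independent set `I`. -/
def IsSplitGraph {V : Type u} (G : SimpleGraph V) : Prop :=
  ∃ K I : Set V, Disjoint K I ∧ K ∪ I = Set.univ ∧ G.IsClique K ∧ G.IsIndepSet I

/-- `G` is `H`-free: no induced subgraph of `G` is isomorphic to `H`. -/
def IsInducedFree {W : Type} (H : SimpleGraph W) {V : Type u} (G : SimpleGraph V) : Prop :=
  ¬ H.IsIndContained G

/-- The graph `F₃`: a clique on the four vertices `0, 1, 2, 3`, a vertex `4` adjacent to exactly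
`1`, and a vertex `5` adjacent to exactly `0` and `1`. -/
def graphF₃ : SimpleGraph (Fin 6) :=
  SimpleGraph.fromEdgeSet
    {s(0, 1), s(1, 2), s(2, 3), s(3, 0), s(0, 2), s(1, 3), s(0, 5), s(5, 1), s(1, 4)}

/-- Construction sequences (expressions) for graphs whose vertices carry labels from a set of `k`
labels, built by the four operations that define clique-width. -/
inductive CWExpr (k : ℕ) : Type
  /-- create a single vertex with label `i` -/
  | vertex (i : Fin k) : CWExpr k
  /-- disjoint union of two labelled graphs -/
  | union (e₁ e₂ : CWExpr k) : CWExpr k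
  /-- join each vertex with label `i` to each vertex with label `j`, where `i ≠ j` -/
  | join (i j : Fin k) (hij : i ≠ j) (e : CWExpr k) : CWExpr k
  /-- rename label `i` to `j` -/
  | rename (i j : Fin k) (e : CWExpr k) : CWExpr k

namespace CWExpr

variable {k : ℕ}

/-- The vertex set of the graph constructed by an expression. -/
def Vert : CWExpr k → Type
  | vertex _ => Unit
  | union e₁ e₂ => e₁.Vert ⊕ e₂.Vert
  | join _ _ _ e => e.Vert
  | rename _ _ e => e.Vert

/-- The labels of the vertices of the graph constructed by an expression. -/
def label : (e : CWExpr k) → e.Vert → Fin k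
  | vertex i => fun _ => i
  | union e₁ e₂ => Sum.elim e₁.label e₂.label
  | join _ _ _ e => e.label
  | rename i j e => fun v => if e.label v = i then j else e.label v

/-- Add all edges between the vertices labelled `i` and the vertices labelled `j`. -/
def joinLabels {V : Type} (G : SimpleGraph V) (l : V → Fin k) (i j : Fin k) (hij : i ≠ j) :
    SimpleGraph V where
  Adj u v := G.Adj u v ∨ (l u = i ∧ l v = j) ∨ (l u = j ∧ l v = i)
  symm := ⟨fun u v h => by
    rcases h with h | ⟨h, h'⟩ | ⟨h, h'⟩
    · exact Or.inl h.symm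
    · exact Or.inr (Or.inr ⟨h', h⟩)
    · exact Or.inr (Or.inl ⟨h', h⟩)⟩
  loopless := ⟨fun u h => by
    rcases h with h | ⟨h, h'⟩ | ⟨h, h'⟩
    · exact G.irrefl h
    · exact hij (h.symm.trans h')
    · exact hij (h'.symm.trans h)⟩

/-- The graph constructed by an expression. -/
def graph : (e : CWExpr k) → SimpleGraph e.Vert
  | vertex _ => (⊥ : SimpleGraph Unit)
  | union e₁ e₂ => e₁.graph ⊕g e₂.graph
  | join i j hij e => joinLabels e.graph e.label i j hij
  | rename _ _ e => e.graph

end CWExpr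

/-- `G` can be constructed (up to isomorphism) with at most `k` labels. -/
def IsConstructibleWith (k : ℕ) {V : Type u} (G : SimpleGraph V) : Prop :=
  ∃ e : CWExpr k, Nonempty (e.graph ≃g G)

/-- The clique-width of `G`: the minimum number of labels needed to construct `G`
(it is `⊤` if `G` cannot be constructed at all, which happens for no finite nonempty graph). -/
noncomputable def cliqueWidth {V : Type u} (G : SimpleGraph V) : ℕ∞ :=
  ⨅ (k : ℕ) (_ : IsConstructibleWith k G), (k : ℕ∞)

/-- A class of graphs has bounded clique-width if there is a constant `c` such that the
clique-width of every (finite, nonempty) graph in the class is at most `c`. -/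
def HasBoundedCliqueWidth (𝒢 : (V : Type u) → SimpleGraph V → Prop) : Prop :=
  ∃ c : ℕ, ∀ (V : Type u) [Finite V] [Nonempty V] (G : SimpleGraph V),
    𝒢 V G → cliqueWidth G ≤ (c : ℕ∞)

/-! Fix a clique K with independent complement. The graph is determined by the neighbourhoods N(y) ⊆
K of the independent vertices y. In a split partition of F₃ the clique side is the whole K₄, or the
K₄ without one of c, d. So two patterns are forbidden: two distinct intersecting neighbourhoods that
both miss two points of K (`AlmostCross`), and three neighbourhoods with traces {b}, {a,b}, {a,b,c}
on points a, b, c (`NoChain`).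

If |K| ≥ 7, consider the neighbourhoods that contain two points and miss two points. By
`exists_exceptional`, after discarding four sets and one point of K, either these sets or their
complements are pairwise disjoint. Every other neighbourhood has at most one point, up to
complementation.

The disjoint parts of K are placed one after another on a line, each independent vertex just before
its part or level with its single point. At every cut, the vertices on the left show at most 13
behaviours towards the right (`cliqueWidth_le_of_disjoint_parts`). Inserting vertices in this order
takes 2·13 + 1 = 27 labels (`cliqueWidth_le_of_layout`). A clique with at most six vertices is
treated directly. -/

/-! ### Labelled constructions inside a fixed vertex set -/

/-- The relation `adj` on `s`, with the vertices labelled by `lab`, is constructed by an expression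
with `k` labels. -/
def Realizable {V : Type u} (k : ℕ) (adj : V → V → Prop) (s : Set V) (lab : V → Fin k) : Prop :=
  ∃ (e : CWExpr k) (φ : e.Vert → V), Function.Injective φ ∧ Set.range φ = s ∧
    (∀ x y, e.graph.Adj x y ↔ adj (φ x) (φ y)) ∧ ∀ x, e.label x = lab (φ x)

namespace Realizable

variable {V : Type u} {k : ℕ} {adj adj' : V → V → Prop} {s t : Set V} {lab lab' : V → Fin k}

theorem congr (h : Realizable k adj s lab) (hadj : ∀ x ∈ s, ∀ y ∈ s, adj x y ↔ adj' x y)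
    (hlab : ∀ x ∈ s, lab x = lab' x) : Realizable k adj' s lab' := by
  obtain ⟨e, φ, hφ, rfl, h1, h2⟩ := h
  refine ⟨e, φ, hφ, rfl, fun x y => ?_, fun x => ?_⟩
  · rw [h1, hadj _ ⟨x, rfl⟩ _ ⟨y, rfl⟩]
  · rw [h2, hlab _ ⟨x, rfl⟩]

theorem singleton (v : V) (h : ¬ adj v v) (lab : V → Fin k) : Realizable k adj {v} lab :=
  ⟨CWExpr.vertex (lab v), fun _ => v, fun _ _ _ => rfl, Set.range_const (ι := Unit),
    fun _ _ => ⟨fun h' => h'.elim, fun h' => (h h').elim⟩, fun _ => rfl⟩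

theorem union (hs : Realizable k adj s lab) (ht : Realizable k adj t lab) (hst : Disjoint s t)
    (h : ∀ x ∈ s, ∀ y ∈ t, ¬ adj x y ∧ ¬ adj y x) : Realizable k adj (s ∪ t) lab := by
  obtain ⟨e₁, φ₁, hφ₁, rfl, h1, h2⟩ := hs
  obtain ⟨e₂, φ₂, hφ₂, rfl, h3, h4⟩ := ht
  refine ⟨CWExpr.union e₁ e₂, Sum.elim φ₁ φ₂, ?_, Set.Sum.elim_range _ _, ?_, ?_⟩
  · refine hφ₁.sumElim hφ₂ fun a b hab => ?_
    exact Set.disjoint_left.1 hst ⟨a, rfl⟩ ⟨b, hab.symm⟩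
  · rintro (x | x) (y | y)
    · exact h1 x y
    · exact ⟨fun h' => by simp [CWExpr.graph] at h', fun h' => ((h _ ⟨x, rfl⟩ _ ⟨y, rfl⟩).1 h').elim⟩
    · exact ⟨fun h' => by simp [CWExpr.graph] at h', fun h' => ((h _ ⟨y, rfl⟩ _ ⟨x, rfl⟩).2 h').elim⟩
    · exact h3 x y
  · rintro (x | x)
    · exact h2 x
    · exact h4 x

theorem join (h : Realizable k adj s lab) {i j : Fin k} (hij : i ≠ j) :
    Realizable k (fun x y => adj x y ∨ (lab x = i ∧ lab y = j) ∨ (lab x = j ∧ lab y = i)) s lab := by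
  obtain ⟨e, φ, hφ, rfl, h1, h2⟩ := h
  have (x y : e.Vert) :
      (e.graph.Adj x y ∨ (e.label x = i ∧ e.label y = j) ∨ (e.label x = j ∧ e.label y = i)) ↔
      (adj (φ x) (φ y) ∨ (lab (φ x) = i ∧ lab (φ y) = j) ∨ (lab (φ x) = j ∧ lab (φ y) = i)) := by
    rw [h1, h2, h2]
  exact ⟨CWExpr.join i j hij e, φ, hφ, rfl, this, h2⟩

theorem rename (h : Realizable k adj s lab) (i j : Fin k) :
    Realizable k adj s (fun x => if lab x = i then j else lab x) := by
  obtain ⟨e, φ, hφ, rfl, h1, h2⟩ := h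
  have (x : e.Vert) : (if e.label x = i then j else e.label x) =
      if lab (φ x) = i then j else lab (φ x) := by rw [h2]
  exact ⟨CWExpr.rename i j e, φ, hφ, rfl, h1, this⟩

/-- Joining all vertices with label `i` to all vertices whose label lies in `A`. -/
theorem join_finset (h : Realizable k adj s lab) {i : Fin k} (A : Finset (Fin k)) (hi : i ∉ A) :
    Realizable k (fun x y => adj x y ∨ (lab x = i ∧ lab y ∈ A) ∨ (lab x ∈ A ∧ lab y = i))
      s lab := by
  induction A using Finset.induction_on with
  | empty => simpa using h
  | insert j A hj ih =>
    rw [Finset.mem_insert, not_or] at hi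
    refine ((ih hi.2).join hi.1).congr (fun x _ y _ => ?_) fun _ _ => rfl
    simp only [Finset.mem_insert]
    tauto

/-- Renaming all labels in `A` simultaneously, to labels outside of `A`. -/
theorem rename_finset (h : Realizable k adj s lab) (r : Fin k → Fin k) (A : Finset (Fin k))
    (hr : ∀ i ∈ A, r i ∉ A) :
    Realizable k adj s (fun x => if lab x ∈ A then r (lab x) else lab x) := by
  have key : ∀ B ⊆ A, Realizable k adj s (fun x => if lab x ∈ B then r (lab x) else lab x) := by
    intro B
    induction B using Finset.induction_on with
    | empty => intro _; simpa using h
    | insert j B hj ih =>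
      intro hB
      have hjA : j ∈ A := hB (Finset.mem_insert_self _ _)
      have hBA : B ⊆ A := (Finset.subset_insert _ _).trans hB
      refine ((ih hBA).rename j (r j)).congr (fun x _ y _ => Iff.rfl) fun x _ => ?_
      by_cases hx : lab x ∈ B
      -- A label already renamed has left `A`, so the renaming of `j` cannot catch it.
      · have : r (lab x) ≠ j := fun h' => hr _ (hBA hx) (h' ▸ hjA)
        simp [hx, this]
      · by_cases hxj : lab x = j
        · simp [hxj, hj]
        · simp [hx, hxj]
  exact key A subset_rfl

end Realizable

theorem cliqueWidth_le_of_realizable {V : Type u} {k : ℕ} {G : SimpleGraph V} {lab : V → Fin k}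
    (h : Realizable k G.Adj Set.univ lab) : cliqueWidth G ≤ k := by
  obtain ⟨e, φ, hφ, hr, h1, -⟩ := h
  refine iInf₂_le (f := fun (k : ℕ) (_ : IsConstructibleWith k G) => (k : ℕ∞)) k
    ⟨e, ⟨⟨Equiv.ofBijective φ ⟨hφ, Set.range_eq_univ.1 hr⟩, ?_⟩⟩⟩
  intro x y
  exact (h1 x y).symm

/-! ### From linear layouts to clique-width -/

/-- Adding a vertex `a` to a labelled graph, and relabelling afterwards.  The labels in use are
those in the image of `ι`; the labels in the image of `κ` and `z` are auxiliary. -/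
theorem Realizable.insert_vertex {V : Type u} {K : ℕ} {L : Type} [Finite L] {G : SimpleGraph V} {s : Set V}
    {ι κ : L → Fin K} {z : Fin K} (hι : Function.Injective ι) (hκ : Function.Injective κ)
    (hικ : ∀ i j, ι i ≠ κ j) (hιz : ∀ i, ι i ≠ z) (hκz : ∀ i, κ i ≠ z) {l : V → L}
    (h : Realizable K G.Adj s (fun x => ι (l x))) {a : V} (ha : a ∉ s)
    (hl : ∀ u ∈ s, ∀ v ∈ s, l u = l v → (G.Adj u a ↔ G.Adj v a)) (r : L → L) (la : L)
    {l' : V → L} (hl' : ∀ x ∈ s, l' x = r (l x)) (hla : l' a = la) :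
    Realizable K G.Adj (insert a s) (fun x => ι (l' x)) := by
  classical
  have := Fintype.ofFinite L
  have h1 : Realizable K (fun x y => G.Adj x y ∧ x ≠ a ∧ y ≠ a) ({a} ∪ s)
      (fun x => if x = a then z else ι (l x)) := by
    refine (Realizable.singleton a (by simp) _).union
      (h.congr (fun x hx y hy => ?_) fun x hx => ?_) (by simpa using ha) (by simp)
    · have hxa : x ≠ a := fun h' => ha (h' ▸ hx)
      have hya : y ≠ a := fun h' => ha (h' ▸ hy)
      simp [hxa, hya]
    · have hxa : x ≠ a := fun h' => ha (h' ▸ hx)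
      simp [hxa]
  -- By `hl` the neighbours of `a` in `s` form a union of label classes, so joining `z` to the
  -- labels in `N` adds exactly the edges at `a`.
  let N : Finset (Fin K) := Finset.univ.filter fun i => ∃ x ∈ s, G.Adj x a ∧ ι (l x) = i
  have hN : ∀ x ∈ s, (ι (l x) ∈ N ↔ G.Adj x a) := by
    intro x hx
    simp only [N, Finset.mem_filter, Finset.mem_univ, true_and]
    constructor
    · rintro ⟨y, hy, hya, hxy⟩
      exact (hl y hy x hx (hι hxy)).1 hya
    · exact fun hxa => ⟨x, hx, hxa, rfl⟩
  have hzN : z ∉ N := by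
    simp only [N, Finset.mem_filter, Finset.mem_univ, true_and]
    rintro ⟨y, -, -, hy⟩
    exact hιz _ hy
  have h2 : Realizable K G.Adj ({a} ∪ s) (fun x => if x = a then z else ι (l x)) := by
    refine (h1.join_finset N hzN).congr ?_ fun _ _ => rfl
    have hns : ∀ x ∈ s, x ≠ a := fun x hx h' => ha (h' ▸ hx)
    rintro x (rfl | hx) y (rfl | hy)
    · simp [hzN]
    · simp [hns y hy, hN y hy, hzN, hιz, G.adj_comm x y]
    · simp [hns x hx, hN x hx, hzN, hιz]
    · simp [hns x hx, hns y hy, hιz]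
  -- first move all labels to the image of `κ`, then back to the image of `ι`
  let m : Fin K → Fin K := fun i => if h : ∃ j, ι j = i then κ (r h.choose) else κ la
  have hm : ∀ j, m (ι j) = κ (r j) := by
    intro j
    have hj : ∃ j', ι j' = ι j := ⟨j, rfl⟩
    simp only [m, dif_pos hj]
    rw [hι hj.choose_spec]
  have hmz : m z = κ la := dif_neg fun ⟨j, hj⟩ => hιz j hj
  let A : Finset (Fin K) := insert z (Finset.univ.image ι)
  have h3 := h2.rename_finset m A (by
    intro i hi
    simp only [A, Finset.mem_insert, Finset.mem_image, Finset.mem_univ, true_and] at hi ⊢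
    rcases hi with rfl | ⟨j, rfl⟩
    · rw [hmz]; rintro (h | ⟨j, h⟩); exacts [hκz _ h, hικ _ _ h]
    · rw [hm]; rintro (h | ⟨j, h⟩); exacts [hκz _ h, hικ _ _ h])
  have h4 : Realizable K G.Adj ({a} ∪ s) (fun x => κ (l' x)) := by
    refine h3.congr (fun _ _ _ _ => Iff.rfl) ?_
    rintro x (rfl | hx)
    · simp [A, hmz, hla]
    · have hxa : x ≠ a := fun h' => ha (h' ▸ hx)
      simp [A, hxa, hm, hl' x hx]
  let b : Fin K → Fin K := fun i => if h : ∃ j, κ j = i then ι h.choose else z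
  have hb : ∀ j, b (κ j) = ι j := by
    intro j
    have hj : ∃ j', κ j' = κ j := ⟨j, rfl⟩
    simp only [b, dif_pos hj]
    rw [hκ hj.choose_spec]
  refine ((h4.rename_finset b (Finset.univ.image κ) ?_).congr (fun _ _ _ _ => Iff.rfl) ?_)
  · intro i hi
    simp only [Finset.mem_image, Finset.mem_univ, true_and] at hi ⊢
    rcases hi with ⟨j, rfl⟩
    rw [hb]; rintro ⟨j', h⟩; exact hικ _ _ h.symm
  · intro x _
    simp [hb]

/-- A linear layout of a graph in which the vertices of each initial part fall into at most
`card L` classes with respect to their neighbours in the final part bounds the clique-width. -/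
theorem cliqueWidth_le_of_layout {V : Type u} [Finite V] [Nonempty V] (G : SimpleGraph V)
    {α : Type*} [LinearOrder α] (f : V → α) (L : Type) [Fintype L]
    (h : ∀ t, ∃ l : V → L, ∀ u v, f u ≤ t → f v ≤ t → l u = l v →
      ∀ w, w ≠ u → w ≠ v → t ≤ f w → (G.Adj u w ↔ G.Adj v w)) :
    cliqueWidth G ≤ (2 * Fintype.card L + 1 : ℕ) := by
  classical
  have := Fintype.ofFinite V
  set K := 2 * Fintype.card L + 1 with hK
  have hcard : Fintype.card ((L ⊕ L) ⊕ Unit) = K := by simp [hK]; ring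
  let E : (L ⊕ L) ⊕ Unit ≃ Fin K := Fintype.equivFinOfCardEq hcard
  let ι : L → Fin K := fun i => E (.inl (.inl i))
  let κ : L → Fin K := fun i => E (.inl (.inr i))
  let z : Fin K := E (.inr ())
  have hι : Function.Injective ι := fun i j hij => by simpa [ι] using hij
  have hκ : Function.Injective κ := fun i j hij => by simpa [κ] using hij
  have hικ : ∀ i j, ι i ≠ κ j := fun i j hij => by simp [ι, κ] at hij
  have hιz : ∀ i, ι i ≠ z := fun i hij => by simp [ι, z] at hij
  have hκz : ∀ i, κ i ≠ z := fun i hij => by simp [κ, z] at hij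
  have key : ∀ s : Finset V, s.Nonempty → ∀ t, (∀ x ∈ s, f x ≤ t) →
      ∃ l : V → L, Realizable K G.Adj (s : Set V) (fun x => ι (l x)) ∧
        ∀ u ∈ s, ∀ v ∈ s, l u = l v → ∀ w, w ∉ s → t ≤ f w → (G.Adj u w ↔ G.Adj v w) := by
    intro s
    induction s using Finset.induction_on_max_value f with
    | empty => intro h; simp at h
    | insert a s has hmax ih =>
      intro _ t ht
      obtain ⟨l₀, hl₀⟩ := h t
      rcases s.eq_empty_or_nonempty with rfl | hs
      · refine ⟨l₀, ?_, ?_⟩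
        · simpa using Realizable.singleton a (by simp) _
        · simp
      obtain ⟨l, hl, hl1⟩ := ih hs (f a) hmax
      have hta : f a ≤ t := ht a (Finset.mem_insert_self _ _)
      -- Labels can be merged but never split, while `l₀` may separate vertices that share a label
      -- under `l`. So a whole class of `l` receives the `l₀`-label of one representative, which has
      -- the same later neighbours.
      let r : L → L := fun i => if h : ∃ x ∈ s, l x = i then l₀ h.choose else l₀ a
      have hr : ∀ x ∈ s, ∃ y ∈ s, l y = l x ∧ r (l x) = l₀ y := by
        intro x hx
        have hex : ∃ y ∈ s, l y = l x := ⟨x, hx, rfl⟩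
        refine ⟨hex.choose, hex.choose_spec.1, hex.choose_spec.2, ?_⟩
        simp only [r, dif_pos hex]
      let l' : V → L := fun x => if x = a then l₀ a else r (l x)
      have hns : ∀ x ∈ s, x ≠ a := fun x hx h' => has (h' ▸ hx)
      refine ⟨l', ?_, ?_⟩
      · rw [Finset.coe_insert]
        refine hl.insert_vertex hι hκ hικ hιz hκz (by simpa using has) ?_ r (l₀ a) (l' := l') ?_ ?_
        · intro u hu v hv huv
          exact hl1 u hu v hv huv a has le_rfl
        · intro x hx
          simp [l', hns x hx]
        · simp [l']
      · have hrep : ∀ x ∈ insert a s, ∃ y ∈ insert a s, l' x = l₀ y ∧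
            ∀ w, w ∉ insert a s → t ≤ f w → (G.Adj x w ↔ G.Adj y w) := by
          intro x hx
          rcases Finset.mem_insert.1 hx with rfl | hx
          · exact ⟨x, Finset.mem_insert_self _ _, by simp [l'], fun _ _ _ => Iff.rfl⟩
          · obtain ⟨y, hy, hyx, hry⟩ := hr x hx
            refine ⟨y, Finset.mem_insert_of_mem hy, by simp [l', hns x hx, hry], ?_⟩
            intro w hw htw
            exact hl1 x hx y hy hyx.symm w (fun h' => hw (Finset.mem_insert_of_mem h'))
              (hta.trans htw)
        intro u hu v hv huv w hw htw
        obtain ⟨u', hu', hu1, hu2⟩ := hrep u hu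
        obtain ⟨v', hv', hv1, hv2⟩ := hrep v hv
        rw [hu2 w hw htw, hv2 w hw htw]
        exact hl₀ u' v' (ht _ hu') (ht _ hv') (hu1.symm.trans (huv.trans hv1)) w
          (fun h' => hw (h' ▸ hu')) (fun h' => hw (h' ▸ hv')) htw
  obtain ⟨v₀, -, hv₀⟩ := Finset.exists_max_image (Finset.univ : Finset V) f Finset.univ_nonempty
  obtain ⟨l, hl, -⟩ := key Finset.univ Finset.univ_nonempty (f v₀) hv₀
  rw [Finset.coe_univ] at hl
  exact cliqueWidth_le_of_realizable hl

/-! ### Set families without the two forbidden patterns -/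

/-- Two sets of `𝓕` are disjoint or their complements in `K` are almost disjoint. -/
def AlmostCross {V : Type u} (K : Finset V) (𝓕 : Set (Finset V)) : Prop :=
  ∀ A ∈ 𝓕, ∀ B ∈ 𝓕, A ≠ B → (∃ x, x ∈ A ∧ x ∈ B) →
    ∀ p ∈ K, ∀ q ∈ K, p ∉ A → p ∉ B → q ∉ A → q ∉ B → p = q

/-- There is no chain pattern on three sets of `𝓕`. -/
def NoChain {V : Type u} (K : Finset V) (𝓕 : Set (Finset V)) : Prop :=
  ∀ A ∈ 𝓕, ∀ B ∈ 𝓕, ∀ C ∈ 𝓕, ∀ a ∈ K, ∀ b, ∀ c ∈ K,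
    c ∉ A → c ∉ B → c ∈ C → a ∉ A → a ∈ B → a ∈ C → b ∈ A → b ∈ B → b ∈ C → False

/-- A set meeting one of two disjoint members of `𝓕` meets the other one. -/
theorem AlmostCross.meets_of_disjoint {V : Type u} {K : Finset V} {𝓕 : Set (Finset V)}
    (h : AlmostCross K 𝓕) (hsub : ∀ A ∈ 𝓕, A ⊆ K) (h2 : ∀ A ∈ 𝓕, ∃ p ∈ A, ∃ q ∈ A, p ≠ q)
    {A B C : Finset V} (hA : A ∈ 𝓕) (hB : B ∈ 𝓕) (hC : C ∈ 𝓕) (hBC : Disjoint B C) (hAB : A ≠ B)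
    (hx : ∃ x, x ∈ A ∧ x ∈ B) : ∃ x, x ∈ A ∧ x ∈ C := by
  by_contra! hAC
  obtain ⟨p, hp, q, hq, hpq⟩ := h2 C hC
  exact hpq (h A hA B hB hAB hx p (hsub C hC hp) q (hsub C hC hq) (fun h' => hAC p h' hp)
    (Finset.disjoint_right.1 hBC hp) (fun h' => hAC q h' hq) (Finset.disjoint_right.1 hBC hq))

/-- A further member meeting `B₁` would meet all three. It misses two points, and each `Bᵢ` must
contain one of them, which is impossible for three disjoint sets. So nothing else meets `B₁`, and
two intersecting members would both miss two points of `B₁`. -/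
theorem disjoint_of_three_disjoint {V : Type u} {K : Finset V} {𝓕 : Set (Finset V)}
    (hsub : ∀ A ∈ 𝓕, A ⊆ K) (h2 : ∀ A ∈ 𝓕, ∃ p ∈ A, ∃ q ∈ A, p ≠ q)
    (h2' : ∀ A ∈ 𝓕, ∃ p ∈ K, ∃ q ∈ K, p ∉ A ∧ q ∉ A ∧ p ≠ q) (h : AlmostCross K 𝓕)
    {B₁ B₂ B₃ : Finset V} (hB₁ : B₁ ∈ 𝓕) (hB₂ : B₂ ∈ 𝓕) (hB₃ : B₃ ∈ 𝓕) (h₁₂ : Disjoint B₁ B₂)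
    (h₁₃ : Disjoint B₁ B₃) (h₂₃ : Disjoint B₂ B₃) :
    ∀ A ∈ 𝓕, ∀ B ∈ 𝓕, A ≠ B → Disjoint A B := by
  have key : ∀ A ∈ 𝓕, A ≠ B₁ → Disjoint A B₁ := by
    intro A hA hA₁
    by_contra hd
    rw [Finset.not_disjoint_iff] at hd
    by_cases hA₂ : A = B₂
    · subst hA₂
      obtain ⟨x, hx, hx'⟩ := hd
      exact Finset.disjoint_left.1 h₁₂ hx' hx
    by_cases hA₃ : A = B₃
    · subst hA₃
      obtain ⟨x, hx, hx'⟩ := hd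
      exact Finset.disjoint_left.1 h₁₃ hx' hx
    have m₂ := h.meets_of_disjoint hsub h2 hA hB₁ hB₂ h₁₂ hA₁ hd
    have m₃ := h.meets_of_disjoint hsub h2 hA hB₁ hB₃ h₁₃ hA₁ hd
    obtain ⟨p, hp, q, hq, hpA, hqA, hpq⟩ := h2' A hA
    have e₁ := h A hA B₁ hB₁ hA₁ hd p hp q hq hpA
    have e₂ := h A hA B₂ hB₂ hA₂ m₂ p hp q hq hpA
    have e₃ := h A hA B₃ hB₃ hA₃ m₃ p hp q hq hpA
    have n₁ : p ∈ B₁ ∨ q ∈ B₁ := by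
      by_contra! hn
      exact hpq (e₁ hn.1 hqA hn.2)
    have n₂ : p ∈ B₂ ∨ q ∈ B₂ := by
      by_contra! hn
      exact hpq (e₂ hn.1 hqA hn.2)
    have n₃ : p ∈ B₃ ∨ q ∈ B₃ := by
      by_contra! hn
      exact hpq (e₃ hn.1 hqA hn.2)
    rw [Finset.disjoint_left] at h₁₂ h₁₃ h₂₃
    rcases n₁ with n₁ | n₁ <;> rcases n₂ with n₂ | n₂ <;> rcases n₃ with n₃ | n₃ <;>
      first
      | exact h₁₂ n₁ n₂
      | exact h₁₃ n₁ n₃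
      | exact h₂₃ n₂ n₃
  intro A hA B hB hAB
  by_cases hA₁ : A = B₁
  · subst hA₁; exact (key B hB hAB.symm).symm
  by_cases hB₁' : B = B₁
  · subst hB₁'; exact key A hA hAB
  have hAd := key A hA hA₁
  have hBd := key B hB hB₁'
  by_contra hd
  rw [Finset.not_disjoint_iff] at hd
  obtain ⟨p, hp, q, hq, hpq⟩ := h2 B₁ hB₁
  exact hpq (h A hA B hB hAB hd p (hsub _ hB₁ hp) q (hsub _ hB₁ hq) (Finset.disjoint_right.1 hAd hp)
    (Finset.disjoint_right.1 hBd hp) (Finset.disjoint_right.1 hAd hq)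
    (Finset.disjoint_right.1 hBd hq))

/-- Two sets with complements of size at most `m` have a large intersection. -/
theorem card_le_card_inter_add {V : Type u} [DecidableEq V] {K A B : Finset V} {m : ℕ}
    (hA : (K \ A).card ≤ m) (hB : (K \ B).card ≤ m) : K.card ≤ (A ∩ B).card + 2 * m := by
  have : K ⊆ (A ∩ B) ∪ ((K \ A) ∪ (K \ B)) := by
    intro x hx
    simp only [Finset.mem_union, Finset.mem_inter, Finset.mem_sdiff]
    tauto
  have h1 := Finset.card_le_card this
  have h2 := Finset.card_union_le (A ∩ B) ((K \ A) ∪ (K \ B))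
  have h3 := Finset.card_union_le (K \ A) (K \ B)
  omega

/-- If no three sets of `𝓕` are pairwise disjoint, then apart from two exceptional sets, the
members of `𝓕` are pairwise intersecting. -/
theorem exists_exceptional_not_disjoint {V : Type u} {K : Finset V} {𝓕 : Set (Finset V)}
    (hK : 7 ≤ K.card)
    (hsub : ∀ A ∈ 𝓕, A ⊆ K) (h2 : ∀ A ∈ 𝓕, ∃ p ∈ A, ∃ q ∈ A, p ≠ q) (h : AlmostCross K 𝓕)
    (h3 : ∀ B₁ ∈ 𝓕, ∀ B₂ ∈ 𝓕, ∀ B₃ ∈ 𝓕, Disjoint B₁ B₂ → Disjoint B₁ B₃ → ¬ Disjoint B₂ B₃) :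
    ∃ E₁ E₂ : Finset V, ∀ A ∈ 𝓕, ∀ B ∈ 𝓕, A ≠ E₁ → A ≠ E₂ → B ≠ E₁ → B ≠ E₂ → A ≠ B →
      ¬ Disjoint A B := by
  classical
  by_cases hex : ∃ B₁ ∈ 𝓕, ∃ B₂ ∈ 𝓕, Disjoint B₁ B₂
  swap
  · push Not at hex
    exact ⟨∅, ∅, fun A hA B hB _ _ _ _ _ => hex A hA B hB⟩
  obtain ⟨B₁, hB₁, B₂, hB₂, hd⟩ := hex
  -- Any other `A` meets both `B₁` and `B₂`, so at most one missed point lies outside each; no point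
  -- lies in both.
  have key : ∀ A ∈ 𝓕, A ≠ B₁ → A ≠ B₂ → (K \ A).card ≤ 2 := by
    intro A hA hA₁ hA₂
    have hm : (∃ x, x ∈ A ∧ x ∈ B₁) ∧ ∃ x, x ∈ A ∧ x ∈ B₂ := by
      by_cases h' : Disjoint B₁ A
      · have := h3 B₁ hB₁ B₂ hB₂ A hA hd h'
        rw [disjoint_comm, Finset.not_disjoint_iff] at this
        exact ⟨h.meets_of_disjoint hsub h2 hA hB₂ hB₁ hd.symm hA₂ this, this⟩
      · rw [disjoint_comm, Finset.not_disjoint_iff] at h'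
        exact ⟨h', h.meets_of_disjoint hsub h2 hA hB₁ hB₂ hd hA₁ h'⟩
    have hc₁ : ((K \ A) \ B₁).card ≤ 1 := Finset.card_le_one.2 fun p hp q hq => by
      simp only [Finset.mem_sdiff] at hp hq
      exact h A hA B₁ hB₁ hA₁ hm.1 p hp.1.1 q hq.1.1 hp.1.2 hp.2 hq.1.2 hq.2
    have hc₂ : ((K \ A) \ B₂).card ≤ 1 := Finset.card_le_one.2 fun p hp q hq => by
      simp only [Finset.mem_sdiff] at hp hq
      exact h A hA B₂ hB₂ hA₂ hm.2 p hp.1.1 q hq.1.1 hp.1.2 hp.2 hq.1.2 hq.2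
    have hu : K \ A ⊆ ((K \ A) \ B₁) ∪ ((K \ A) \ B₂) := by
      intro x hx
      have : x ∈ B₁ → x ∉ B₂ := fun h' => Finset.disjoint_left.1 hd h'
      simp only [Finset.mem_union, Finset.mem_sdiff] at hx ⊢
      tauto
    have := Finset.card_le_card hu
    have := Finset.card_union_le ((K \ A) \ B₁) ((K \ A) \ B₂)
    omega
  refine ⟨B₁, B₂, fun A hA B hB h1 h2 h3 h4 _ hAB => ?_⟩
  have := card_le_card_inter_add (key A hA h1 h2) (key B hB h3 h4)
  rw [Finset.disjoint_iff_inter_eq_empty.1 hAB] at this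
  simp at this
  omega

/-- If the complements of the sets of `𝓕` pairwise meet in at most one point, then up to two
exceptional sets and one point they are pairwise disjoint. -/
theorem exists_exceptional_compl_disjoint {V : Type u} {K : Finset V} {𝓕 : Set (Finset V)}
    (hK : 7 ≤ K.card)
    (h2' : ∀ A ∈ 𝓕, ∃ p ∈ K, ∃ q ∈ K, p ∉ A ∧ q ∉ A ∧ p ≠ q)
    (h : ∀ A ∈ 𝓕, ∀ B ∈ 𝓕, A ≠ B →
      ∀ p ∈ K, ∀ q ∈ K, p ∉ A → p ∉ B → q ∉ A → q ∉ B → p = q)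
    (hc : NoChain K 𝓕) :
    ∃ (E₁ E₂ : Finset V) (c : V), ∀ A ∈ 𝓕, ∀ B ∈ 𝓕, A ≠ E₁ → A ≠ E₂ → B ≠ E₁ → B ≠ E₂ → A ≠ B →
      ∀ x ∈ K, x ∉ A → x ∉ B → x = c := by
  classical
  -- If some pair misses a common `c` and shares two points, `NoChain` forces all but two members to
  -- miss `c`, and then complements meet only in `c`.
  by_cases hex : ∃ A ∈ 𝓕, ∃ B ∈ 𝓕, A ≠ B ∧ (∃ c ∈ K, c ∉ A ∧ c ∉ B) ∧
      ∃ b₁ b₂, b₁ ∈ K ∧ b₂ ∈ K ∧ b₁ ∈ A ∧ b₁ ∈ B ∧ b₂ ∈ A ∧ b₂ ∈ B ∧ b₁ ≠ b₂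
  · obtain ⟨A, hA, B, hB, hAB, ⟨c, hcK, hcA, hcB⟩, b₁, b₂, hb₁, hb₂, hbA₁, hbB₁, hbA₂, hbB₂, hb⟩ :=
      hex
    have other : ∀ C ∈ 𝓕, ∃ a ∈ K, a ∉ C ∧ a ≠ c := by
      intro C hC
      obtain ⟨p, hp, q, hq, hpC, hqC, hpq⟩ := h2' C hC
      by_cases hpc : p = c
      · exact ⟨q, hq, hqC, fun h' => hpq (hpc.trans h'.symm)⟩
      · exact ⟨p, hp, hpC, hpc⟩
    obtain ⟨a, haK, haA, hac⟩ := other A hA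
    obtain ⟨e, heK, heB, hec⟩ := other B hB
    have haB : a ∈ B := by
      by_contra haB
      exact hac (h A hA B hB hAB a haK c hcK haA haB hcA hcB)
    have heA : e ∈ A := by
      by_contra heA
      exact hec (h A hA B hB hAB e heK c hcK heA heB hcA hcB)
    have hae : a ≠ e := fun h' => heB (h' ▸ haB)
    have hS₁ : {C ∈ 𝓕 | b₁ ∉ C ∧ b₂ ∉ C}.Subsingleton := by
      rintro C ⟨hC, hC₁, hC₂⟩ D ⟨hD, hD₁, hD₂⟩
      by_contra hCD
      exact hb (h C hC D hD hCD b₁ hb₁ b₂ hb₂ hC₁ hD₁ hC₂ hD₂)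
    have hS₂ : {C ∈ 𝓕 | a ∉ C ∧ e ∉ C}.Subsingleton := by
      rintro C ⟨hC, hC₁, hC₂⟩ D ⟨hD, hD₁, hD₂⟩
      by_contra hCD
      exact hae (h C hC D hD hCD a haK e heK hC₁ hD₁ hC₂ hD₂)
    have sub : ∀ S : Set (Finset V), S.Subsingleton → ∃ E, ∀ C ∈ S, C = E := by
      intro S hS
      rcases hS.eq_empty_or_singleton with rfl | ⟨E, rfl⟩
      · exact ⟨∅, by simp⟩
      · exact ⟨E, by simp⟩
    obtain ⟨E₁, hE₁⟩ := sub _ hS₁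
    obtain ⟨E₂, hE₂⟩ := sub _ hS₂
    -- A member outside the exceptions contains one of `b₁`, `b₂` and one of `a`, `e`; containing
    -- `c` as well would complete a chain above `A` and `B`, in one order or the other.
    have key : ∀ C ∈ 𝓕, C ≠ E₁ → C ≠ E₂ → c ∉ C := by
      intro C hC hC₁ hC₂ hcC
      have n₁ : ¬ (b₁ ∉ C ∧ b₂ ∉ C) := fun h' => hC₁ (hE₁ C ⟨hC, h'⟩)
      have n₂ : ¬ (a ∉ C ∧ e ∉ C) := fun h' => hC₂ (hE₂ C ⟨hC, h'⟩)
      obtain ⟨b, hbA, hbB, hbC⟩ : ∃ b, b ∈ A ∧ b ∈ B ∧ b ∈ C := by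
        by_cases hbC : b₁ ∈ C
        · exact ⟨b₁, hbA₁, hbB₁, hbC⟩
        · exact ⟨b₂, hbA₂, hbB₂, by tauto⟩
      by_cases haC : a ∈ C
      · exact hc A hA B hB C hC a haK b c hcK hcA hcB hcC haA haB haC hbA hbB hbC
      · exact hc B hB A hA C hC e heK b c hcK hcB hcA hcC heB heA (by tauto) hbB hbA hbC
    refine ⟨E₁, E₂, c, fun C hC D hD hC₁ hC₂ hD₁ hD₂ hCD x hx hxC hxD => ?_⟩
    exact h C hC D hD hCD x hx c hcK hxC hxD (key C hC hC₁ hC₂) (key D hD hD₁ hD₂)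
  have small : ∀ A ∈ 𝓕, ∀ B ∈ 𝓕, A ≠ B → (∃ c ∈ K, c ∉ A ∧ c ∉ B) →
      (K ∩ (A ∩ B)).card ≤ 1 := by
    intro A hA B hB hAB hcc
    refine Finset.card_le_one.2 fun p hp q hq => ?_
    simp only [Finset.mem_inter] at hp hq
    by_contra hpq
    exact hex ⟨A, hA, B, hB, hAB, hcc, p, q, hp.1, hq.1, hp.2.1, hp.2.2, hq.2.1, hq.2.2, hpq⟩
  have small' : ∀ A ∈ 𝓕, ∀ B ∈ 𝓕, A ≠ B → (K \ (A ∪ B)).card ≤ 1 := by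
    intro A hA B hB hAB
    refine Finset.card_le_one.2 fun p hp q hq => ?_
    simp only [Finset.mem_sdiff, Finset.mem_union, not_or] at hp hq
    exact h A hA B hB hAB p hp.1 q hq.1 hp.2.1 hp.2.2 hq.2.1 hq.2.2
  obtain ⟨k₀, hk₀⟩ : K.Nonempty := Finset.card_pos.1 (by omega)
  by_cases hpair : ∃ A ∈ 𝓕, ∃ B ∈ 𝓕, A ≠ B ∧ ∃ c ∈ K, c ∉ A ∧ c ∉ B
  swap
  · push Not at hpair
    exact ⟨∅, ∅, k₀, fun A hA B hB _ _ _ _ hAB x hx hxA hxB =>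
      (hxB (hpair A hA B hB hAB x hx hxA)).elim⟩
  obtain ⟨A, hA, B, hB, hAB, hcc⟩ := hpair
  have size : ∀ C ∈ 𝓕, ∀ A ∈ 𝓕, ∀ B ∈ 𝓕, A ≠ B → C ≠ B → (∃ c ∈ K, c ∉ A ∧ c ∉ B) →
      (∀ x ∈ K, x ∉ C → x ∈ A) → (K \ C).card ≤ 2 := by
    intro C hC A hA B hB hAB hCB hcc hCA
    have hu : K \ C ⊆ (K ∩ (A ∩ B)) ∪ (K \ (C ∪ B)) := by
      intro x hx
      have := hCA x
      simp only [Finset.mem_union, Finset.mem_sdiff, Finset.mem_inter] at hx ⊢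
      tauto
    have := Finset.card_le_card hu
    have := Finset.card_union_le (K ∩ (A ∩ B)) (K \ (C ∪ B))
    have := small A hA B hB hAB hcc
    have := small' C hC B hB hCB
    omega
  have key : ∀ C ∈ 𝓕, C ≠ A → C ≠ B → (K \ C).card ≤ 2 := by
    intro C hC hCA hCB
    by_cases h₁ : ∃ c ∈ K, c ∉ C ∧ c ∉ A
    swap
    · push Not at h₁
      exact size C hC A hA B hB hAB hCB hcc h₁
    by_cases h₂ : ∃ c ∈ K, c ∉ C ∧ c ∉ B
    swap
    · push Not at h₂
      obtain ⟨c, hc1, hc2, hc3⟩ := hcc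
      exact size C hC B hB A hA hAB.symm hCA ⟨c, hc1, hc3, hc2⟩ h₂
    have c1 := small A hA B hB hAB hcc
    have c2 := small C hC A hA hCA h₁
    have c3 := small C hC B hB hCB h₂
    have c4 := small' A hA B hB hAB
    have c5 := small' C hC A hA hCA
    have c6 := small' C hC B hB hCB
    -- Each point lies in two of the three sets or is missed by two. The six pieces have at most one
    -- point each, contradicting `7 ≤ K.card`.
    have hu : K ⊆ ((K ∩ (A ∩ B)) ∪ ((K ∩ (C ∩ A)) ∪ (K ∩ (C ∩ B)))) ∪
        ((K \ (A ∪ B)) ∪ ((K \ (C ∪ A)) ∪ (K \ (C ∪ B)))) := by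
      intro x hx
      simp only [Finset.mem_union, Finset.mem_sdiff, Finset.mem_inter]
      tauto
    have u0 := Finset.card_le_card hu
    have u1 := Finset.card_union_le ((K ∩ (A ∩ B)) ∪ ((K ∩ (C ∩ A)) ∪ (K ∩ (C ∩ B))))
      ((K \ (A ∪ B)) ∪ ((K \ (C ∪ A)) ∪ (K \ (C ∪ B))))
    have u2 := Finset.card_union_le (K ∩ (A ∩ B)) ((K ∩ (C ∩ A)) ∪ (K ∩ (C ∩ B)))
    have u3 := Finset.card_union_le (K ∩ (C ∩ A)) (K ∩ (C ∩ B))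
    have u4 := Finset.card_union_le (K \ (A ∪ B)) ((K \ (C ∪ A)) ∪ (K \ (C ∪ B)))
    have u5 := Finset.card_union_le (K \ (C ∪ A)) (K \ (C ∪ B))
    omega
  refine ⟨A, B, k₀, fun C hC D hD hC₁ hC₂ hD₁ hD₂ hCD x hx hxC hxD => ?_⟩
  exfalso
  have i1 := small C hC D hD hCD ⟨x, hx, hxC, hxD⟩
  have hKC : (K \ (K ∩ C)).card ≤ 2 := by
    rw [Finset.sdiff_inter_self_left]; exact key C hC hC₁ hC₂
  have hKD : (K \ D).card ≤ 2 := key D hD hD₁ hD₂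
  have i2 := card_le_card_inter_add hKC hKD
  rw [Finset.inter_assoc] at i2
  omega

/-- Without three disjoint members, two exceptions make the rest intersect pairwise. `AlmostCross`
then lets two complements share at most one point, and two further exceptions make this point always
`c`. -/
theorem exists_exceptional {V : Type u} {K : Finset V} {𝓕 : Set (Finset V)}
    (hK : 7 ≤ K.card) (hsub : ∀ A ∈ 𝓕, A ⊆ K) (h2 : ∀ A ∈ 𝓕, ∃ p ∈ A, ∃ q ∈ A, p ≠ q)
    (h2' : ∀ A ∈ 𝓕, ∃ p ∈ K, ∃ q ∈ K, p ∉ A ∧ q ∉ A ∧ p ≠ q) (h : AlmostCross K 𝓕)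
    (hc : NoChain K 𝓕) :
    ∃ (E : Fin 4 → Finset V) (c : V),
      (∀ A ∈ 𝓕, ∀ B ∈ 𝓕, (∀ i, A ≠ E i) → (∀ i, B ≠ E i) → A ≠ B →
        ∀ x ∈ K, x ∈ A → x ∈ B → x = c) ∨
      (∀ A ∈ 𝓕, ∀ B ∈ 𝓕, (∀ i, A ≠ E i) → (∀ i, B ≠ E i) → A ≠ B →
        ∀ x ∈ K, x ∉ A → x ∉ B → x = c) := by
  by_cases h3 : ∃ B₁ ∈ 𝓕, ∃ B₂ ∈ 𝓕, ∃ B₃ ∈ 𝓕, Disjoint B₁ B₂ ∧ Disjoint B₁ B₃ ∧ Disjoint B₂ B₃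
  · obtain ⟨B₁, hB₁, B₂, hB₂, B₃, hB₃, h₁₂, h₁₃, h₂₃⟩ := h3
    have := disjoint_of_three_disjoint hsub h2 h2' h hB₁ hB₂ hB₃ h₁₂ h₁₃ h₂₃
    obtain ⟨k₀, -⟩ : K.Nonempty := Finset.card_pos.1 (by omega)
    exact ⟨fun _ => ∅, k₀, .inl fun A hA B hB _ _ hAB x _ hxA hxB =>
      (Finset.disjoint_left.1 (this A hA B hB hAB) hxA hxB).elim⟩
  push Not at h3
  obtain ⟨E₁, E₂, hE⟩ := exists_exceptional_not_disjoint hK hsub h2 h h3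
  obtain ⟨E₃, E₄, c, hE'⟩ := exists_exceptional_compl_disjoint
    (𝓕 := {A ∈ 𝓕 | A ≠ E₁ ∧ A ≠ E₂}) hK (fun A hA => h2' A hA.1)
    (fun A hA B hB hAB => h A hA.1 B hB.1 hAB
      (Finset.not_disjoint_iff.1 (hE A hA.1 B hB.1 hA.2.1 hA.2.2 hB.2.1 hB.2.2 hAB)))
    (fun A hA B hB C hC => hc A hA.1 B hB.1 C hC.1)
  refine ⟨![E₁, E₂, E₃, E₄], c, .inr fun A hA B hB hAE hBE hAB => ?_⟩
  exact hE' A ⟨hA, hAE 0, hAE 1⟩ B ⟨hB, hBE 0, hBE 1⟩ (hAE 2) (hAE 3) (hBE 2) (hBE 3) hAB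

/-! ### Layouts of split graphs -/

/-- A split graph in which, apart from one vertex `c` and at most four classes of independent
vertices, the neighbourhoods in the clique are, up to complementation, subsingletons or members of a
family of pairwise disjoint sets. -/
theorem cliqueWidth_le_of_disjoint_parts {V : Type u} [Finite V] [Nonempty V] (G : SimpleGraph V)
    (K : Set V) (hK : G.IsClique K) (hI : G.IsIndepSet Kᶜ) (c : V) (X : Set V) (g : V → Fin 4)
    (hg : ∀ y ∉ K, y ∈ X → ∀ z ∉ K, z ∈ X → g y = g z → ∀ w, G.Adj y w ↔ G.Adj z w)
    (D : V → Set V) (σ : V → Prop) (B : Set V)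
    (hD : ∀ y ∉ K, y ∉ X → ∀ x ∈ K, x ≠ c → (G.Adj y x ↔ (x ∈ D y ↔ σ y)))
    (hsub : ∀ y ∉ K, y ∉ X → y ∉ B → (D y).Subsingleton)
    (hB : ∀ y ∈ B, ∀ z ∈ B, ∀ x, x ∈ D y → x ∈ D z → D y = D z) :
    cliqueWidth G ≤ (27 : ℕ) := by
  classical
  obtain ⟨ι, hι⟩ : ∃ ι : V → ℕ, Function.Injective ι := exists_injective_nat V
  obtain ⟨idx, hidx⟩ : ∃ i : Set V → ℕ, Function.Injective i := exists_injective_nat (Set V)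
  let part : V → ℕ := fun x => if h : ∃ y ∈ B, x ∈ D y then idx (D h.choose) + 1 else 0
  have hpart : ∀ y ∈ B, ∀ x ∈ D y, part x = idx (D y) + 1 := by
    intro y hy x hx
    have h : ∃ y ∈ B, x ∈ D y := ⟨y, hy, hx⟩
    simp only [part, dif_pos h]
    rw [hB _ h.choose_spec.1 y hy x h.choose_spec.2 hx]
  let pos : V → ℕ ×ₗ ℕ := fun x => toLex (part x + 1, ι x + 1)
  have hpos : Function.Injective pos := by
    intro x y hxy
    simp only [pos, toLex_inj, Prod.mk.injEq] at hxy
    exact hι (by omega)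
  -- The part of `D v` has first coordinate `idx (D v) + 2` and positive second coordinates, so a
  -- vertex of `B` comes just before its part. A vertex with one-point `D v` ties with that point.
  let f : V → ℕ ×ₗ ℕ := fun v =>
    if v = c then toLex (0, 0) else if v ∈ K then pos v else if v ∈ X then toLex (0, 0) else
    if v ∈ B then toLex (idx (D v) + 2, 0) else
    if h : (D v).Nonempty then pos h.some else toLex (1, 0)
  have fc : f c = toLex (0, 0) := by simp [f]
  have fK : ∀ v, v ≠ c → v ∈ K → f v = pos v := by
    intro v h1 h2; simp [f, h1, h2]
  have fX : ∀ v ∉ K, v ∈ X → f v = toLex (0, 0) := by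
    intro v h1 h2; simp [f, h1, h2]
  have fB : ∀ v, v ≠ c → v ∉ K → v ∉ X → v ∈ B → f v = toLex (idx (D v) + 2, 0) := by
    intro v h1 h2 h3 h4; simp [f, h1, h2, h3, h4]
  have fS : ∀ v, v ≠ c → v ∉ K → v ∉ X → v ∉ B → ∀ x ∈ D v, f v = pos x := by
    intro v h1 h2 h3 h4 x hx
    have h : (D v).Nonempty := ⟨x, hx⟩
    simp only [f, h1, h2, h3, h4, if_false, dif_pos h]
    rw [hsub v h2 h3 h4 h.some_mem hx]
  have pos_gt : ∀ x, toLex (0, 0) < pos x := by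
    intro x; simp [pos, Prod.Lex.toLex_lt_toLex]
  have f_gt : ∀ v, v ≠ c → v ∉ K → v ∉ X → toLex (0, 0) < f v := by
    intro v h1 h2 h3
    by_cases h4 : v ∈ B
    · rw [fB v h1 h2 h3 h4]; simp [Prod.Lex.toLex_lt_toLex]
    by_cases h : (D v).Nonempty
    · rw [fS v h1 h2 h3 h4 _ h.some_mem]; exact pos_gt _
    · simp [f, h1, h2, h3, h4, h, Prod.Lex.toLex_lt_toLex]
  have f_le : ∀ v, v ≠ c → v ∉ K → v ∉ X → ∀ x ∈ D v, f v ≤ pos x := by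
    intro v h1 h2 h3 x hx
    by_cases h4 : v ∈ B
    · rw [fB v h1 h2 h3 h4]
      simp only [pos, Prod.Lex.toLex_le_toLex, hpart v h4 x hx]
      right; simp
    · exact (fS v h1 h2 h3 h4 x hx).le
  have hL : 2 * Fintype.card (Option (Fin 4 ⊕ Bool ⊕ (Bool × Fin 3))) + 1 = 27 := by
    simp
  rw [← hL]
  refine cliqueWidth_le_of_layout G f _ fun t => ?_
  -- There are 1 + 4 + 2 + 6 = 13 classes. A clique vertex exactly at `t` needs its own label
  -- because an independent vertex may tie with it. Kind 0 means that `D v` lies before the cut;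
  -- kinds 1 and 2 separate parts from single points still reaching it.
  let l : V → Option (Fin 4 ⊕ Bool ⊕ (Bool × Fin 3)) := fun v =>
    if v = c then none else if v ∈ K then some (.inr (.inl (decide (pos v = t)))) else
    if v ∈ X then some (.inl (g v)) else
    some (.inr (.inr (decide (σ v), if ∀ x ∈ D v, ¬ t ≤ pos x then 0 else if v ∈ B then 1 else 2)))
  have lc : ∀ v, l v = none ↔ v = c := by
    intro v
    by_cases h1 : v = c <;> simp only [l, h1, if_true, if_false]
    by_cases h2 : v ∈ K <;> simp only [h2, if_true, if_false, reduceCtorEq]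
    by_cases h3 : v ∈ X <;> simp [h3]
  have lK : ∀ v, v ≠ c → v ∈ K → l v = some (.inr (.inl (decide (pos v = t)))) := by
    intro v h1 h2; simp [l, h1, h2]
  have lX : ∀ v, v ≠ c → v ∉ K → v ∈ X → l v = some (.inl (g v)) := by
    intro v h1 h2 h3; simp [l, h1, h2, h3]
  have lI : ∀ v, v ≠ c → v ∉ K → v ∉ X → l v = some (.inr (.inr (decide (σ v),
      if ∀ x ∈ D v, ¬ t ≤ pos x then 0 else if v ∈ B then 1 else 2))) := by
    intro v h1 h2 h3; simp [l, h1, h2, h3]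
  have nadj : ∀ y ∉ K, ∀ z ∉ K, ¬ G.Adj y z := fun y hy z hz h => hI hy hz h.ne h
  refine ⟨l, fun u v hu hv huv w hwu hwv hw => ?_⟩
  by_cases huc : u = c
  · have hvc : v = c := by rw [← lc, ← huv, lc]; exact huc
    rw [huc, hvc]
  have hvc : v ≠ c := fun h => huc (by rw [← lc, huv, lc]; exact h)
  by_cases huK : u ∈ K
  · have hvK : v ∈ K := by
      by_contra hvK
      rw [lK u huc huK] at huv
      by_cases hvX : v ∈ X
      · rw [lX v hvc hvK hvX] at huv; simp at huv
      · rw [lI v hvc hvK hvX] at huv; simp at huv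
    rw [lK u huc huK, lK v hvc hvK] at huv
    simp only [Option.some.injEq, Sum.inr.injEq, Sum.inl.injEq, decide_eq_decide] at huv
    by_cases hut : pos u = t
    · rw [hpos (hut.trans (huv.1 hut).symm)]
    have hu' : pos u < t := lt_of_le_of_ne (fK u huc huK ▸ hu) hut
    have hv' : pos v < t := lt_of_le_of_ne (fK v hvc hvK ▸ hv) (fun h => hut (huv.2 h))
    by_cases hwK : w ∈ K
    · exact iff_of_true (hK huK hwK hwu.symm) (hK hvK hwK hwv.symm)
    have hw0 : toLex (0, 0) < f w := ((pos_gt u).trans hu').trans_le hw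
    have hwc : w ≠ c := fun h => by rw [h, fc] at hw0; exact lt_irrefl _ hw0
    have hwX : w ∉ X := fun h => by rw [fX w hwK h] at hw0; exact lt_irrefl _ hw0
    -- An independent vertex never comes after a point of its `D`.
    have key : ∀ x, pos x < t → x ∉ D w := fun x hx hxw =>
      absurd ((hw.trans (f_le w hwc hwK hwX x hxw)).trans_lt hx) (lt_irrefl _)
    rw [G.adj_comm u, G.adj_comm v, hD w hwK hwX u huK huc, hD w hwK hwX v hvK hvc]
    have := key u hu'
    have := key v hv'
    tauto
  have hvK : v ∉ K := by
    intro hvK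
    rw [lK v hvc hvK] at huv
    by_cases huX : u ∈ X
    · rw [lX u huc huK huX] at huv; simp at huv
    · rw [lI u huc huK huX] at huv; simp at huv
  by_cases huX : u ∈ X
  · have hvX : v ∈ X := by
      by_contra hvX
      rw [lX u huc huK huX, lI v hvc hvK hvX] at huv; simp at huv
    rw [lX u huc huK huX, lX v hvc hvK hvX] at huv
    exact hg u huK huX v hvK hvX (by simpa using huv) w
  have hvX : v ∉ X := by
    intro hvX
    rw [lI u huc huK huX, lX v hvc hvK hvX] at huv; simp at huv
  by_cases hwK : w ∈ K
  swap
  · exact iff_of_false (nadj u huK w hwK) (nadj v hvK w hwK)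
  have hw0 : toLex (0, 0) < f w := ((f_gt u huc huK huX).trans_le hu).trans_le hw
  have hwc : w ≠ c := fun h => by rw [h, fc] at hw0; exact lt_irrefl _ hw0
  rw [fK w hwc hwK] at hw
  rw [lI u huc huK huX, lI v hvc hvK hvX] at huv
  simp only [Option.some.injEq, Sum.inr.injEq, Prod.mk.injEq, decide_eq_decide] at huv
  obtain ⟨hσ, hkind⟩ := huv
  -- parts meeting both the initial and the final segment are determined by `t`
  have hcur : ∀ y, y ≠ c → y ∉ K → y ∉ X → y ∈ B → f y ≤ t → ∀ x ∈ D y, t ≤ pos x →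
      (ofLex t).1 = idx (D y) + 2 := by
    intro y h1 h2 h3 h4 h5 x hx hxt
    rw [fB y h1 h2 h3 h4] at h5
    have e1 := hpart y h4 x hx
    obtain ⟨⟨p, q⟩, rfl⟩ := toLex.surjective t
    simp only [pos, Prod.Lex.toLex_le_toLex, e1] at h5 hxt
    simp only [ofLex_toLex]
    omega
  have hsing : ∀ y, y ≠ c → y ∉ K → y ∉ X → y ∉ B → f y ≤ t → ∀ x ∈ D y, t ≤ pos x →
      pos x = t := by
    intro y h1 h2 h3 h4 h5 x hx hxt
    rw [fS y h1 h2 h3 h4 x hx] at h5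
    exact le_antisymm h5 hxt
  have hmem : w ∈ D u ↔ w ∈ D v := by
    by_cases hu0 : ∀ x ∈ D u, ¬ t ≤ pos x
    · have hv0 : ∀ x ∈ D v, ¬ t ≤ pos x := by
        by_contra hv0
        rw [if_pos hu0, if_neg hv0] at hkind
        split_ifs at hkind <;> simp at hkind
      exact iff_of_false (fun h => hu0 w h hw) (fun h => hv0 w h hw)
    have hv0 : ¬ ∀ x ∈ D v, ¬ t ≤ pos x := by
      intro hv0
      rw [if_neg hu0, if_pos hv0] at hkind
      split_ifs at hkind <;> simp at hkind
    rw [if_neg hu0, if_neg hv0] at hkind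
    push Not at hu0 hv0
    obtain ⟨x, hxu, hxt⟩ := hu0
    obtain ⟨x', hxv, hxt'⟩ := hv0
    by_cases huB : u ∈ B
    · have hvB : v ∈ B := by
        by_contra hvB
        rw [if_pos huB, if_neg hvB] at hkind
        simp at hkind
      have e1 := hcur u huc huK huX huB hu x hxu hxt
      have e2 := hcur v hvc hvK hvX hvB hv x' hxv hxt'
      rw [hidx (show idx (D u) = idx (D v) by omega)]
    · have hvB : v ∉ B := by
        intro hvB
        rw [if_neg huB, if_pos hvB] at hkind
        simp at hkind
      have e1 := hsing u huc huK huX huB hu x hxu hxt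
      have e2 := hsing v hvc hvK hvX hvB hv x' hxv hxt'
      have hxx : x = x' := hpos (e1.trans e2.symm)
      subst hxx
      constructor
      · intro h; rw [hsub u huK huX huB h hxu]; exact hxv
      · intro h; rw [hsub v hvK hvX hvB h hxv]; exact hxu
  rw [hD u huK huX w hwK hwc, hD v hvK hvX w hwK hwc, hmem, hσ]

/-- A split graph with a small clique has bounded clique-width. -/
theorem cliqueWidth_le_of_ncard_clique_le {V : Type u} [Finite V] [Nonempty V] (G : SimpleGraph V)
    (K : Set V) (hI : G.IsIndepSet Kᶜ) (h : K.ncard ≤ 6) : cliqueWidth G ≤ (27 : ℕ) := by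
  classical
  -- Six values would suffice; twelve make the bound equal to 27.
  obtain ⟨j, hj⟩ : ∃ j : V → Fin 12, Set.InjOn j K := by
    have := Fintype.ofFinite K
    have hc : Fintype.card K ≤ Fintype.card (Fin 12) := by
      rw [← Nat.card_eq_fintype_card, Nat.card_coe_set_eq]; simp; omega
    obtain ⟨e⟩ := Function.Embedding.nonempty_of_card_le hc
    refine ⟨fun v => if h : v ∈ K then e ⟨v, h⟩ else 0, fun x hx y hy hxy => ?_⟩
    simpa [hx, hy] using hxy
  have hL : 2 * Fintype.card (Option (Fin 12)) + 1 = 27 := by simp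
  rw [← hL]
  refine cliqueWidth_le_of_layout G (fun v => if v ∈ K then 0 else 1) _
    fun t : ℕ => ⟨fun v => if v ∈ K then some (j v) else none, ?_⟩
  intro u v hu hv huv w hwu hwv hw
  by_cases huK : u ∈ K
  · have hvK : v ∈ K := by by_contra hvK; simp [huK, hvK] at huv
    simp only [huK, hvK, if_true, Option.some.injEq] at huv
    rw [hj huK hvK huv]
  · have hvK : v ∉ K := by intro hvK; simp [huK, hvK] at huv
    have hwK : w ∉ K := by
      intro hwK
      simp only [huK, hwK, if_true, if_false] at hu hw
      omega
    exact iff_of_false (fun h => hI huK hwK h.ne h) (fun h => hI hvK hwK h.ne h)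

/-! ### The two forbidden patterns contain F₃ -/

instance : DecidableRel graphF₃.Adj := fun a b => by
  unfold graphF₃
  rw [SimpleGraph.fromEdgeSet_adj]
  simp only [Set.mem_insert_iff, Set.mem_singleton_iff]
  infer_instance

/-- Distinct vertices of F₃ have distinct neighbourhoods, so preserving and reflecting adjacency
already makes `f` injective. -/
theorem isIndContained_graphF₃ {V : Type u} {G : SimpleGraph V} (f : Fin 6 → V)
    (h : ∀ i j, i < j → (G.Adj (f i) (f j) ↔ graphF₃.Adj i j)) : graphF₃.IsIndContained G := by
  have h' : ∀ i j, G.Adj (f i) (f j) ↔ graphF₃.Adj i j := by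
    intro i j
    rcases lt_trichotomy i j with hij | rfl | hij
    · exact h i j hij
    · simp
    · rw [G.adj_comm, h j i hij, graphF₃.adj_comm]
  have hinj : Function.Injective f := by
    intro i j hij
    have key : ∀ i j : Fin 6, (∀ k, graphF₃.Adj i k ↔ graphF₃.Adj j k) → i = j := by decide
    exact key i j fun k => by rw [← h', ← h', hij]
  exact ⟨⟨⟨f, hinj⟩, h' _ _⟩⟩

theorem isIndContained_graphF₃_of_adj {V : Type u} {G : SimpleGraph V} {a b c d y z : V}
    (hab : G.Adj a b) (hac : G.Adj a c) (had : G.Adj a d) (hbc : G.Adj b c) (hbd : G.Adj b d)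
    (hcd : G.Adj c d) (hay : ¬ G.Adj a y) (hby : G.Adj b y) (hcy : ¬ G.Adj c y)
    (hdy : ¬ G.Adj d y) (haz : G.Adj a z) (hbz : G.Adj b z) (hcz : ¬ G.Adj c z)
    (hdz : ¬ G.Adj d z) (hyz : ¬ G.Adj y z) : graphF₃.IsIndContained G := by
  refine isIndContained_graphF₃ ![a, b, c, d, y, z] fun i j hij => ?_
  fin_cases i <;> fin_cases j <;>
    first
    | exact absurd hij (by decide)
    | exact iff_of_true (by assumption) (by decide)
    | exact iff_of_false (by assumption) (by decide)

/-- The K₄ of F₃ lies in `K`: a shared point plays `b`, a point of only one set plays `a`, and two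
points missed by both play `c` and `d`. -/
theorem almostCross_of_free {V : Type u} {G : SimpleGraph V} {K : Set V} (hK : G.IsClique K)
    (hI : G.IsIndepSet Kᶜ) (hG : IsInducedFree graphF₃ G) {F : Finset V} (hF : ∀ x, x ∈ F ↔ x ∈ K)
    {N : V → Finset V} (hN : ∀ y x, x ∈ N y ↔ x ∈ K ∧ G.Adj y x) :
    AlmostCross F {A | ∃ y ∉ K, N y = A} := by
  have key : ∀ y ∉ K, ∀ z ∉ K, ∀ a, a ∈ N z → a ∉ N y → ∀ x, x ∈ N y → x ∈ N z →
      ∀ p ∈ F, ∀ q ∈ F, p ∉ N y → p ∉ N z → q ∉ N y → q ∉ N z → p = q := by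
    intro y hy z hz a haz hay x hxy hxz p hp q hq hpy hpz hqy hqz
    by_contra hpq
    have ne : ∀ {A : Finset V} {u v : V}, u ∈ A → v ∉ A → u ≠ v := fun hu hv h => hv (h ▸ hu)
    have hyz : y ≠ z := fun h => hay (h ▸ haz)
    have hax := ne hxy hay
    have hap := ne haz hpz
    have haq := ne haz hqz
    have hxp := ne hxz hpz
    have hxq := ne hxz hqz
    rw [hF] at hp hq
    rw [hN] at haz hay hxy hxz hpy hpz hqy hqz
    refine hG (isIndContained_graphF₃_of_adj (a := a) (b := x) (c := p) (d := q) (y := y) (z := z)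
      (hK haz.1 hxy.1 hax.symm) (hK haz.1 hp hap) (hK haz.1 hq haq) (hK hxy.1 hp hxp)
      (hK hxy.1 hq hxq) (hK hp hq hpq) (fun h => hay ⟨haz.1, h.symm⟩) hxy.2.symm
      (fun h => hpy ⟨hp, h.symm⟩) (fun h => hqy ⟨hq, h.symm⟩) haz.2.symm hxz.2.symm
      (fun h => hpz ⟨hp, h.symm⟩) (fun h => hqz ⟨hq, h.symm⟩) (hI hy hz hyz))
  rintro _ ⟨y, hy, rfl⟩ _ ⟨z, hz, rfl⟩ hyz ⟨x, hxy, hxz⟩ p hp q hq hpy hpz hqy hqz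
  by_cases h : N z ⊆ N y
  · have h' : ¬ N y ⊆ N z := fun h' => hyz (h'.antisymm h)
    obtain ⟨a, ha, ha'⟩ := Finset.not_subset.1 h'
    exact key z hz y hy a ha ha' x hxz hxy p hp q hq hpz hpy hqz hqy
  · obtain ⟨a, ha, ha'⟩ := Finset.not_subset.1 h
    exact key y hy z hz a ha ha' x hxy hxz p hp q hq hpy hpz hqy hqz

/-- Here `d` is an independent vertex, and `y`, `z`, `d` see the nested traces on the triangle `a`,
`b`, `c`. -/
theorem noChain_of_free {V : Type u} {G : SimpleGraph V} {K : Set V} (hK : G.IsClique K)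
    (hI : G.IsIndepSet Kᶜ) (hG : IsInducedFree graphF₃ G) {F : Finset V} (hF : ∀ x, x ∈ F ↔ x ∈ K)
    {N : V → Finset V} (hN : ∀ y x, x ∈ N y ↔ x ∈ K ∧ G.Adj y x) :
    NoChain F {A | ∃ y ∉ K, N y = A} := by
  rintro _ ⟨y, hy, rfl⟩ _ ⟨z, hz, rfl⟩ _ ⟨d, hd, rfl⟩
  intro a ha b c hc hcy hcz hcd hay haz had hby hbz hbd
  have ne : ∀ {A : Finset V} {u v : V}, u ∈ A → v ∉ A → u ≠ v := fun hu hv h => hv (h ▸ hu)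
  have hab := ne hby hay
  have hac := ne haz hcz
  have hbc := ne hby hcy
  have hyz : y ≠ z := fun h => hay (h ▸ haz)
  have hdy : d ≠ y := fun h => hcy (h ▸ hcd)
  have hdz : d ≠ z := fun h => hcz (h ▸ hcd)
  rw [hF] at ha hc
  rw [hN] at hcy hcz hcd hay haz had hby hbz hbd
  exact hG (isIndContained_graphF₃_of_adj (a := a) (b := b) (c := c) (d := d) (y := y) (z := z)
    (hK ha hby.1 hab.symm) (hK ha hc hac) had.2.symm (hK hby.1 hc hbc) hbd.2.symm hcd.2.symm
    (fun h => hay ⟨ha, h.symm⟩) hby.2.symm (fun h => hcy ⟨hc, h.symm⟩) (hI hd hy hdy)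
    haz.2.symm hbz.2.symm (fun h => hcz ⟨hc, h.symm⟩) (hI hd hz hdz) (hI hy hz hyz))

/-! ### Assembling the bound -/

theorem cliqueWidth_le_of_free {V : Type u} [Finite V] [Nonempty V] (G : SimpleGraph V)
    (hS : IsSplitGraph G) (hG : IsInducedFree graphF₃ G) : cliqueWidth G ≤ (27 : ℕ) := by
  classical
  obtain ⟨K, I, hKI, hun, hK, hI⟩ := hS
  obtain rfl : I = Kᶜ := (IsCompl.of_eq hKI.eq_bot hun).compl_eq.symm
  by_cases hcard : K.ncard ≤ 6
  · exact cliqueWidth_le_of_ncard_clique_le G K hI hcard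
  have := Fintype.ofFinite V
  let F : Finset V := K.toFinite.toFinset
  let N : V → Finset V := fun y => F.filter (G.Adj y)
  have hF : ∀ x, x ∈ F ↔ x ∈ K := by simp [F]
  have hN : ∀ y x, x ∈ N y ↔ x ∈ K ∧ G.Adj y x := by simp [N, hF]
  have hFcard : 7 ≤ F.card := by
    rw [Set.ncard_eq_toFinset_card K] at hcard
    exact Nat.not_le.1 hcard
  have hcross := almostCross_of_free hK hI hG hF hN
  have hchain := noChain_of_free hK hI hG hF hN
  let big : Finset V → Prop := fun A =>
    (∃ p ∈ A, ∃ q ∈ A, p ≠ q) ∧ ∃ p ∈ F, ∃ q ∈ F, p ∉ A ∧ q ∉ A ∧ p ≠ q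
  obtain ⟨E, c, hE⟩ := exists_exceptional (K := F) (𝓕 := {A | (∃ y ∉ K, N y = A) ∧ big A}) hFcard
    (by rintro _ ⟨⟨y, -, rfl⟩, -⟩; exact Finset.filter_subset _ _)
    (fun A hA => hA.2.1) (fun A hA => hA.2.2)
    (fun A hA B hB => hcross A hA.1 B hB.1)
    (fun A hA B hB C hC => hchain A hA.1 B hB.1 C hC.1)
  let X : Set V := {y | ∃ i, N y = E i}
  -- `P A` says that `A` itself, and not its complement, is used as a part
  obtain ⟨P, hP₁, hP₂, hP₃⟩ : ∃ P : Finset V → Prop,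
      (∀ A, ¬ big A → P A → ∀ p ∈ A, ∀ q ∈ A, p = q) ∧
      (∀ A, ¬ big A → ¬ P A → ∀ p ∈ F, ∀ q ∈ F, p ∉ A → q ∉ A → p = q) ∧
      ∀ y ∉ K, y ∉ X → big (N y) → ∀ z ∉ K, z ∉ X → big (N z) → N y ≠ N z →
        (P (N y) ∧ P (N z) ∧ ∀ x ∈ F, x ∈ N y → x ∈ N z → x = c) ∨
        (¬ P (N y) ∧ ¬ P (N z) ∧ ∀ x ∈ F, x ∉ N y → x ∉ N z → x = c) := by
    have cosub : ∀ A, ¬ big A → (¬ ∀ p ∈ A, ∀ q ∈ A, p = q) →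
        ∀ p ∈ F, ∀ q ∈ F, p ∉ A → q ∉ A → p = q := by
      intro A hA hs p hp q hq hpA hqA
      push Not at hs
      by_contra hpq
      exact hA ⟨hs, p, hp, q, hq, hpA, hqA, hpq⟩
    rcases hE with hE | hE
    · refine ⟨fun A => big A ∨ ∀ p ∈ A, ∀ q ∈ A, p = q, fun A hA h => h.resolve_left hA,
        fun A hA h => cosub A hA fun h' => h (.inr h'), ?_⟩
      intro y hy hyX hyb z hz hzX hzb hyz
      exact .inl ⟨.inl hyb, .inl hzb, hE _ ⟨⟨y, hy, rfl⟩, hyb⟩ _ ⟨⟨z, hz, rfl⟩, hzb⟩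
        (fun i h => hyX ⟨i, h⟩) (fun i h => hzX ⟨i, h⟩) hyz⟩
    · have nsub : ∀ A, big A → ¬ ∀ p ∈ A, ∀ q ∈ A, p = q := by
        rintro A ⟨⟨p, hp, q, hq, hpq⟩, -⟩ h
        exact hpq (h p hp q hq)
      -- Big sets are now replaced by their complements; among the others only sets with at most one
      -- point are kept as they are.
      refine ⟨fun A => ∀ p ∈ A, ∀ q ∈ A, p = q, fun A _ h => h, cosub, ?_⟩
      intro y hy hyX hyb z hz hzX hzb hyz
      exact .inr ⟨nsub _ hyb, nsub _ hzb, hE _ ⟨⟨y, hy, rfl⟩, hyb⟩ _ ⟨⟨z, hz, rfl⟩, hzb⟩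
        (fun i h => hyX ⟨i, h⟩) (fun i h => hzX ⟨i, h⟩) hyz⟩
  let part : Finset V → Set V := fun A => {x | x ∈ F ∧ x ≠ c ∧ (x ∈ A ↔ P A)}
  refine cliqueWidth_le_of_disjoint_parts G K hK hI c X
    (fun y => if h : ∃ i, N y = E i then h.choose else 0) ?_ (fun y => part (N y))
    (fun y => P (N y)) {y | y ∉ K ∧ y ∉ X ∧ big (N y)} ?_ ?_ ?_
  · intro y hy hyX z hz hzX hyz w
    have hyX' : ∃ i, N y = E i := hyX
    have hzX' : ∃ i, N z = E i := hzX
    simp only [dif_pos hyX', dif_pos hzX'] at hyz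
    have hNN : N y = N z := by rw [hyX'.choose_spec, hzX'.choose_spec, hyz]
    by_cases hw : w ∈ K
    · have := hN y w
      rw [hNN, hN] at this
      tauto
    · exact iff_of_false (fun h => hI hy hw h.ne h) (fun h => hI hz hw h.ne h)
  · intro y hy hyX x hx hxc
    have h1 := hN y x
    have h2 := hF x
    simp only [part, Set.mem_ofPred_eq]
    tauto
  · intro y hy hyX hyB p ⟨hp, _, hpP⟩ q ⟨hq, _, hqP⟩
    have hyb : ¬ big (N y) := fun h => hyB ⟨hy, hyX, h⟩
    by_cases hPy : P (N y)
    · exact hP₁ _ hyb hPy p (hpP.2 hPy) q (hqP.2 hPy)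
    · exact hP₂ _ hyb hPy p hp q hq (fun h => hPy (hpP.1 h)) (fun h => hPy (hqP.1 h))
  · rintro y ⟨hy, hyX, hyb⟩ z ⟨hz, hzX, hzb⟩ x ⟨hxF, hxc, hxy⟩ ⟨-, -, hxz⟩
    by_cases hyz : N y = N z
    · rw [hyz]
    rcases hP₃ y hy hyX hyb z hz hzX hzb hyz with ⟨h1, h2, h3⟩ | ⟨h1, h2, h3⟩
    · exact (hxc (h3 x hxF (hxy.2 h1) (hxz.2 h2))).elim
    · exact (hxc (h3 x hxF (fun h => h1 (hxy.1 h)) (fun h => h2 (hxz.1 h)))).elim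

theorem theorem10 :
    HasBoundedCliqueWidth.{u} (fun _ G => IsSplitGraph G ∧ IsInducedFree graphF₃ G) :=
  ⟨27, fun _ _ _ G h => cliqueWidth_le_of_free G h.1 h.2⟩
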